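/- Fix $h\ge 1$. For $k,l\ge 1$ let $\mathbb T_{k,l}$ be the forest of $l$ disjoint rooted trees, each with levels of depth $0,1,\dots,h-1$ (roots have depth $0$), in which nodes of even depth ("rectangle nodes") and nodes of odd depth ("circle nodes") alternate: every rectangle node of depth $<h-1$ has exactly $k$ children and every circle node of depth $<h-1$ has exactly one child. View $\mathbb T_{k,l}$ as a structure over the vocabulary $\mathcal V_h=\{u,d\}\cup\{p_i : -1\le i\le h-1\}$, where $u,d$ are unary function symbols and the $p_i$ are binary predicate symbols: $u(e)=d(e)=e$ for a rectangle node $e$; for a circle node $c$, $u(c)$ is its parent and $d(c)$ its only child (with $d(c)=c$ if $c$ is a leaf, which can occur only for even $h$); and $p_i(a,b)$ holds iff the lowest common ancestor of $a$ and $b$ has depth $i$, where for two nodes in different trees this depth is taken to be $-1$. Let $\mathcal K_h$ be the class of all structures isomorphic to a substructure (possibly empty) of some $\mathbb T_{k,l}$, $k,l\ge1$. Then $\mathcal K_h$ has a Fraïssé limit $\mathbb T_{\mathrm{forest}}$, i.e. a countable homogeneous $\mathcal V_h$-structure whose finitely generated substructures are, up to isomorphism, exactly the members of $\mathcal K_h$.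 Moreover, let $\mathbb T=\mathbb T_{\mathrm{forest}}$ be any such limit, let $\mathcal Q$ be a finite relational vocabulary (disjoint from the symbols of $\mathcal V_h$ and from $\mathbb T$) all of whose symbols have arity at most $1$, and call a finite set of atomic formulas $q(a_1,\dots,a_{\mathrm{ar}(q)})$ with $q\in\mathcal Q$ and $a_1,\dots,a_{\mathrm{ar}(q)}\in\mathbb T$ a configuration. For configurations $\mathcal C,\mathcal C'$ write $\mathcal C\preceq\mathcal C'$ if there is an automorphism $\pi$ of $\mathbb T$ such that $q(\pi(a_1),\dots,\pi(a_{\mathrm{ar}(q)}))\in\mathcal C'$ for every $q(a_1,\dots,a_{\mathrm{ar}(q)})\in\mathcal C$. Then, for every set $\mathscr C$ of configurations, $\preceq$ is a well-quasi-order on $\mathscr C$: it is reflexive and transitive, and every infinite sequence $\mathcal C_1,\mathcal C_2,\dots$ in $\mathscr C$ has indices $i<j$ with $\mathcal C_i\preceq\mathcal C_j$. -/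

import Mathlib

open FirstOrder CategoryTheory

universe u v w

/-! ### The vocabulary of fixed-height forests -/

/-- The function symbols: `up` and `down`, both unary. -/
inductive ForestFunc : ℕ → Type
  | up : ForestFunc 1
  | down : ForestFunc 1

/-- The predicate symbols: one binary symbol `p_i` for every `i ∈ {-1, …, h - 1}`. -/
inductive ForestRel (h : ℕ) : ℕ → Type
  | lcaDepth (i : Set.Icc (-1 : ℤ) ((h : ℤ) - 1)) : ForestRel h 2

/-- The vocabulary of forests of height `h`. -/
def forestLang (h : ℕ) : FirstOrder.Language.{0, 0} where
  Functions := ForestFunc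
  Relations := ForestRel h

instance forestLang.countable_functions (h : ℕ) :
    Countable (Σ n, (forestLang h).Functions n) := by
  have hs : Function.Surjective (fun b : Bool =>
      (if b then ⟨1, ForestFunc.up⟩ else ⟨1, ForestFunc.down⟩ :
        Σ n, (forestLang h).Functions n)) := by
    rintro ⟨_, f⟩
    cases f
    · exact ⟨true, rfl⟩
    · exact ⟨false, rfl⟩
  exact hs.countable

/-! ### The concrete forests -/

/-- A node of the forest whose trees are indexed by `ι`, all of height `h` (the depths are
`0, …, h - 1`, roots having depth `0`).  The nodes of even depth are the rectangle nodes, each with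
one child for every element of `β`; the nodes of odd depth are the circle nodes, each with one
single child.  In both cases the children are absent when the node has depth `h - 1`.
A node is given by its tree, its depth and the list of the choices made at the rectangle nodes
strictly above it on the path from the root; there are `⌈depth / 2⌉` of these. -/
@[ext]
structure ForestNode (h : ℕ) (ι β : Type) where
  tree : ι
  depth : ℕ
  depth_lt : depth < h
  branch : List β
  length_branch : branch.length = (depth + 1) / 2

namespace ForestNode

variable {h : ℕ} {ι β : Type}

/-- `u`: a circle node is sent to its parent; a rectangle node is fixed. -/
def up (x : ForestNode h ι β) : ForestNode h ι β :=
  if hx : Odd x.depth then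
    { tree := x.tree
      depth := x.depth - 1
      depth_lt := lt_of_le_of_lt (Nat.sub_le _ _) x.depth_lt
      branch := x.branch.dropLast
      length_branch := by
        obtain ⟨m, hm⟩ := hx
        rw [List.length_dropLast, x.length_branch]
        omega }
  else x

/-- `d`: a circle node is sent to its only child (to itself if it is a leaf, which happens only
when `h` is even); a rectangle node is fixed. -/
def down (x : ForestNode h ι β) : ForestNode h ι β :=
  if hx : Odd x.depth ∧ x.depth + 1 < h then
    { tree := x.tree
      depth := x.depth + 1
      depth_lt := hx.2
      branch := x.branch
      length_branch := by
        obtain ⟨m, hm⟩ := hx.1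
        rw [x.length_branch]
        omega }
  else x

/-- `a` is an ancestor of `b` (every node is an ancestor of itself): `a` lies on the path from the
root to `b`. -/
def IsAncestor (a b : ForestNode h ι β) : Prop :=
  a.tree = b.tree ∧ a.depth ≤ b.depth ∧ a.branch <+: b.branch

/-- `c` is the lowest common ancestor of `a` and `b`. -/
def IsLCA (c a b : ForestNode h ι β) : Prop :=
  c.IsAncestor a ∧ c.IsAncestor b ∧
    ∀ e : ForestNode h ι β, e.IsAncestor a → e.IsAncestor b → e.IsAncestor c

/-- The lowest common ancestor of `a` and `b` has depth `i`; two nodes of different trees have by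
convention a lowest common ancestor of depth `-1`. -/
def LCADepth (i : ℤ) (a b : ForestNode h ι β) : Prop :=
  (∃ c : ForestNode h ι β, c.IsLCA a b ∧ (c.depth : ℤ) = i) ∨ (a.tree ≠ b.tree ∧ i = -1)

instance instStructure : (forestLang h).Structure (ForestNode h ι β) where
  funMap := fun f x =>
    match f, x with
    | ForestFunc.up, x => (x 0).up
    | ForestFunc.down, x => (x 0).down
  RelMap := fun r x =>
    match r, x with
    | ForestRel.lcaDepth i, x => LCADepth i.1 (x 0) (x 1)

end ForestNode

/-- The forest `𝕋_{k,l}`: `l` trees of height `h` in which the rectangle nodes have `k` children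
and the circle nodes have one. -/
abbrev FiniteForest (h k l : ℕ) : Type := ForestNode h (Fin l) (Fin k)

/-- The class of all (finitely generated) structures which are, up to isomorphism, substructures of
some `𝕋_{k,l}` with `k, l ≥ 1`. -/
def forestClass (h : ℕ) : Set (Bundled.{w} (forestLang h).Structure) :=
  {M | FirstOrder.Language.Structure.FG (forestLang h) M ∧
    ∃ k l : ℕ, 1 ≤ k ∧ 1 ≤ l ∧ Nonempty (M ↪[forestLang h] FiniteForest h k l)}

/-! ### Configurations and the covering relation -/

/-- The atomic formulas `q(a₁, …, aₙ)`, with `q` an `n`-ary predicate symbol of `Q` and `aᵢ ∈ T`. -/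
structure PAAtom (Q : FirstOrder.Language.{u, v}) (T : Type w) : Type (max v w) where
  arity : ℕ
  symb : Q.Relations arity
  args : Fin arity → T

/-- Renaming the nodes of an atomic formula along a map. -/
def PAAtom.map {Q : FirstOrder.Language.{u, v}} {T : Type w} (π : T → T) (A : PAAtom Q T) : PAAtom Q T :=
  ⟨A.arity, A.symb, fun i => π (A.args i)⟩

/-- Configurations of `T`-predicate automata with vocabulary `Q`: finite sets of atomic formulas. -/
abbrev PAConfig (Q : FirstOrder.Language.{u, v}) (T : Type w) : Type (max v w) := Finset (PAAtom Q T)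

/-- The covering relation `C ≼ C'`: some automorphism of the `L`-structure `T` maps every atomic
formula of `C` to an atomic formula of `C'`. -/
def Covers (L : FirstOrder.Language.{0, 0}) {Q : FirstOrder.Language.{u, v}} {T : Type w} [L.Structure T]
    (C C' : PAConfig Q T) : Prop :=
  ∃ π : T ≃[L] T, ∀ A ∈ C, A.map π ∈ C'

/-! The limit is the concrete forest `ForestNode h ℕ ℕ`, with infinitely many trees and infinite
branching. A node is determined by its depth and its code in `List ℕ`, and every automorphism of the
tree of finite sequences acts on the forest (`actEquiv`).

Homogeneity: depths of lowest common ancestors determine how far codes agree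
(`LCADepth.take_code_eq_iff`), and a finite partial map preserving this agreement extends to a tree
automorphism (`exists_isTreeAut_extending`). The age is right because the codes of finitely many
generators use only finitely many numbers.

Well-quasi-order: by uniqueness of Fraïssé limits it suffices to treat this forest. With arities at
most 1, a configuration is a finitely supported labelling of a tree of bounded height by subsets of
a finite set. Induction on the height shows that these are well-quasi-ordered
(`partiallyWellOrderedOn_dominated`): root labels range over a finite set, and Higman's lemma
compares the finite lists of labelled subtrees. -/

/-! ### Automorphisms of the infinitely branching tree -/

/-- A permutation of the finite sequences is an automorphism of the tree of all finite sequences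
if it commutes with truncation. -/
def IsTreeAut {α : Type*} (e : List α ≃ List α) : Prop :=
  ∀ l j, e (l.take j) = (e l).take j

namespace IsTreeAut

variable {α : Type*} {e e' : List α ≃ List α}

theorem refl : IsTreeAut (Equiv.refl (List α)) := fun _ _ => rfl

theorem symm (he : IsTreeAut e) : IsTreeAut e.symm := fun l j => by
  rw [Equiv.symm_apply_eq, he, Equiv.apply_symm_apply]

theorem trans (he : IsTreeAut e) (he' : IsTreeAut e') : IsTreeAut (e.trans e') := fun l j => by
  simp only [Equiv.trans_apply, he l j, he' _ j]

theorem length_le (he : IsTreeAut e) (l : List α) : (e l).length ≤ l.length := by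
  have h := he l l.length
  rw [List.take_length] at h
  rw [h]
  exact List.length_take_le _ _

theorem length_eq (he : IsTreeAut e) (l : List α) : (e l).length = l.length :=
  le_antisymm (he.length_le l) (by simpa using he.symm.length_le (e l))

theorem apply_nil (he : IsTreeAut e) : e [] = [] :=
  List.length_eq_zero_iff.1 (he.length_eq [])

theorem prefix_of_prefix (he : IsTreeAut e) {l l' : List α} (h : l <+: l') : e l <+: e l' := by
  rw [List.prefix_iff_eq_take] at h
  rw [h, he]
  exact List.take_prefix _ _

theorem prefix_iff (he : IsTreeAut e) {l l' : List α} : e l <+: e l' ↔ l <+: l' :=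
  ⟨fun h => by simpa using he.symm.prefix_of_prefix h, he.prefix_of_prefix⟩

end IsTreeAut

/-- The permutation of the finite sequences that acts by `σ` on the first entry `a` and by `e a` on
the remaining entries. -/
def consAut {α : Type*} (σ : Equiv.Perm α) (e : α → (List α ≃ List α)) : List α ≃ List α where
  toFun
    | [] => []
    | a :: l => σ a :: e a l
  invFun
    | [] => []
    | a :: l => σ.symm a :: (e (σ.symm a)).symm l
  left_inv l := by cases l <;> simp
  right_inv l := by cases l <;> simp

section consAut

variable {α : Type*} (σ : Equiv.Perm α) (e : α → (List α ≃ List α))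

@[simp]
theorem consAut_nil : consAut σ e [] = [] := rfl

@[simp]
theorem consAut_cons (a : α) (l : List α) : consAut σ e (a :: l) = σ a :: e a l := rfl

theorem isTreeAut_consAut (he : ∀ a, IsTreeAut (e a)) : IsTreeAut (consAut σ e) := by
  rintro (_ | ⟨a, l⟩) (_ | j)
  · simp
  · simp
  · simp
  · simp [he a l j]

end consAut

/-- A finite partial injection of an infinite type extends to a permutation. -/
theorem exists_perm_extending {α : Type*} [Infinite α] {s : Set α} (hs : s.Finite) (f : α → α)
    (hf : Set.InjOn f s) : ∃ σ : Equiv.Perm α, ∀ a ∈ s, σ a = f a := by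
  obtain ⟨g, hg⟩ := Cardinal.extend_function_of_lt (α := α) (β := α) (s := s)
    ⟨fun x => f x, fun x y hxy => Subtype.ext (hf x.2 y.2 hxy)⟩
    (hs.lt_aleph0.trans_le (Cardinal.aleph0_le_mk α)) ⟨Equiv.refl α⟩
  exact ⟨g, fun a ha => hg ⟨a, ha⟩⟩

/-- A finite partial map between sequences which preserves lengths and the lengths of common
prefixes extends to an automorphism of the tree of finite sequences. -/
theorem exists_isTreeAut_extending {α : Type*} [Infinite α] (n : ℕ) :
    ∀ P : Set (List α × List α), P.Finite → (∀ p ∈ P, p.1.length ≤ n) →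
      (∀ p ∈ P, p.1.length = p.2.length) →
      (∀ p ∈ P, ∀ q ∈ P, ∀ j, j ≤ p.1.length → j ≤ q.1.length →
        (p.1.take j = q.1.take j ↔ p.2.take j = q.2.take j)) →
      ∃ e : List α ≃ List α, IsTreeAut e ∧ ∀ p ∈ P, e p.1 = p.2 := by
  induction n with
  | zero =>
    intro P _ hn hl _
    refine ⟨Equiv.refl _, IsTreeAut.refl, fun p hp => ?_⟩
    have h1 := List.length_eq_zero_iff.1 (Nat.le_zero.1 (hn p hp))
    have h2 : p.2.length = 0 := by rw [← hl p hp, h1]; rfl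
    rw [List.length_eq_zero_iff] at h2
    simp [h1, h2]
  | succ n ih =>
    intro P hP hn hl hc
    -- The hypothesis at `j = 1` makes the action on first entries well defined here, and injective
    -- for `σ` below.
    have hex : ∀ a : α, ∃ b : α, ∀ l m c, (a :: l, c :: m) ∈ P → c = b := by
      intro a
      by_cases h : ∃ l m c, (a :: l, c :: m) ∈ P
      · obtain ⟨l, _, c, hp⟩ := h
        refine ⟨c, fun l' m' c' hp' => ?_⟩
        have := (hc _ hp' _ hp 1 (by simp) (by simp)).1 (by simp)
        simpa using this
      · exact ⟨a, fun l m c hp => absurd ⟨l, m, c, hp⟩ h⟩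
    choose f hf using hex
    obtain ⟨σ, hσ⟩ := exists_perm_extending (s := {a | ∃ l m c, (a :: l, c :: m) ∈ P})
      ((hP.image fun p => p.1.head?).preimage (f := some)
        (Option.some_injective _).injOn |>.subset (by
          rintro a ⟨l, m, c, hp⟩
          exact ⟨_, hp, rfl⟩)) f (by
        rintro a ⟨l, m, c, hp⟩ a' ⟨l', m', c', hp'⟩ hfa
        have h1 := hf _ _ _ _ hp
        have h2 := hf _ _ _ _ hp'
        have := (hc _ hp _ hp' 1 (by simp) (by simp)).2 (by simp [h1, h2, hfa])
        simpa using this)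
    have hE : ∀ a, ∃ e : List α ≃ List α, IsTreeAut e ∧
        ∀ p ∈ {p : List α × List α | (a :: p.1, σ a :: p.2) ∈ P}, e p.1 = p.2 := by
      intro a
      refine ih _ (hP.preimage (f := fun p : List α × List α => (a :: p.1, σ a :: p.2)) ?_) ?_ ?_ ?_
      · rintro ⟨p1, p2⟩ _ ⟨q1, q2⟩ _ hpq
        simpa using hpq
      · intro p hp
        simpa using hn _ hp
      · intro p hp
        simpa using hl _ hp
      · intro p hp q hq j h1 h2
        simpa using hc _ hp _ hq (j + 1) (by simpa using h1) (by simpa using h2)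
    choose e he hep using hE
    refine ⟨consAut σ e, isTreeAut_consAut σ e he, ?_⟩
    rintro ⟨_ | ⟨a, l⟩, _ | ⟨b, m⟩⟩ hp
    · rfl
    · simpa using hl _ hp
    · simpa using hl _ hp
    · have hb : b = σ a := (hf _ _ _ _ hp).trans (hσ a ⟨_, _, _, hp⟩).symm
      subst hb
      simp only [consAut_cons]
      rw [hep a (l, m) hp]

/-! ### Finitely supported labellings of the tree -/

/-- A labelling `c` is dominated by `c'` if some automorphism of the tree maps every label of `c`
into the label of `c'`. -/
def Dominated {α X : Type*} (c c' : List α → Set X) : Prop :=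
  ∃ e : List α ≃ List α, IsTreeAut e ∧ ∀ l, c l ⊆ c' (e l)

instance Dominated.isPreorder {α X : Type*} :
    IsPreorder (List α → Set X) Dominated where
  refl _ := ⟨Equiv.refl _, IsTreeAut.refl, fun _ => subset_rfl⟩
  trans _ _ _ := fun ⟨e, he, h⟩ ⟨e', he', h'⟩ =>
    ⟨e.trans e', he.trans he', fun l => (h l).trans (h' (e l))⟩

/-- A sublist embedding is a finite injection of positions, so it extends to a permutation of `ℕ`.
That it is increasing is not needed: siblings in the tree are unordered. -/
theorem exists_perm_of_sublistForall₂ {β : Type*} {r : β → β → Prop} {L L' : List β}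
    (h : List.SublistForall₂ r L L') :
    ∃ σ : Equiv.Perm ℕ, ∀ i (hi : i < L.length), ∃ hi' : σ i < L'.length, r L[i] L'[σ i] := by
  obtain ⟨M, hM, hML⟩ := List.sublistForall₂_iff.1 h
  obtain ⟨g, hg⟩ := List.sublist_iff_exists_fin_orderEmbedding_get_eq.1 hML
  obtain ⟨hlen, hr⟩ := List.forall₂_iff_get.1 hM
  obtain ⟨σ, hσ⟩ := exists_perm_extending (s := Set.Iio L.length) (Set.finite_Iio _)
    (fun i => if hi : i < M.length then (g ⟨i, hi⟩ : ℕ) else 0) (by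
      intro i hi j hj hij
      rw [Set.mem_Iio, hlen] at hi hj
      simp only [hi, hj, dif_pos] at hij
      simpa using g.injective (Fin.ext hij))
  refine ⟨σ, fun i hi => ?_⟩
  have hi2 : i < M.length := hlen ▸ hi
  have h1 : σ i = g ⟨i, hi2⟩ := by rw [hσ i hi, dif_pos hi2]
  refine ⟨h1 ▸ (g ⟨i, hi2⟩).2, ?_⟩
  have h2 := hr i hi hi2
  rw [hg] at h2
  simpa [h1] using h2

/-- Labellings of bounded height with finite support are well-quasi-ordered by domination. -/
theorem partiallyWellOrderedOn_dominated {X : Type*} [Finite X] (n : ℕ) :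
    {c : List ℕ → Set X | {l | (c l).Nonempty}.Finite ∧
      ∀ l, n ≤ l.length → c l = ∅}.PartiallyWellOrderedOn Dominated := by
  induction n with
  | zero =>
    rw [Set.partiallyWellOrderedOn_iff_exists_lt]
    intro f hf
    refine ⟨0, 1, one_pos, Equiv.refl _, IsTreeAut.refl, fun l => ?_⟩
    rw [(hf 0).2 l (Nat.zero_le _)]
    exact Set.empty_subset _
  | succ n ih =>
    rw [Set.partiallyWellOrderedOn_iff_exists_lt]
    intro f hf
    -- By finite support, only finitely many subtrees below the root carry labels, so a finite list
    -- records them all.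
    have hN : ∀ k, ∃ N : ℕ, ∀ i, N ≤ i → ∀ l, f k (i :: l) = ∅ := by
      intro k
      obtain ⟨N, hN⟩ := ((hf k).1.image List.headI).bddAbove
      refine ⟨N + 1, fun i hi l => Set.not_nonempty_iff_eq_empty.1 fun hne => ?_⟩
      have : i ≤ N := hN ⟨i :: l, hne, rfl⟩
      omega
    choose N hN using hN
    have hprod := (Set.finite_univ (α := Set X)).partiallyWellOrderedOn (r := (· ⊆ ·)) |>.prod
      (Set.PartiallyWellOrderedOn.partiallyWellOrderedOn_sublistForall₂ Dominated ih)
    obtain ⟨k, k', hkk', h1, h2⟩ := hprod.exists_lt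
      (f := fun k => (f k [], (List.range (N k)).map fun i l => f k (i :: l))) (by
        intro k
        refine ⟨trivial, ?_⟩
        simp only [Set.mem_ofPred_eq, List.mem_map]
        rintro _ ⟨i, -, rfl⟩
        refine ⟨(hf k).1.preimage (f := fun l => i :: l) (List.cons_injective.injOn), fun l hl => ?_⟩
        exact (hf k).2 _ (by simpa using hl))
    refine ⟨k, k', hkk', ?_⟩
    obtain ⟨σ, hσ⟩ := exists_perm_of_sublistForall₂ h2
    have he : ∀ i, Dominated (fun l => f k (i :: l)) (fun l => f k' (σ i :: l)) := by
      intro i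
      by_cases hi : i < N k
      · obtain ⟨_, h⟩ := hσ i (by simpa using hi)
        simpa using h
      -- A subtree without labels is dominated by whichever subtree `σ` assigns to it.
      · refine ⟨Equiv.refl _, IsTreeAut.refl, fun l => ?_⟩
        dsimp only
        rw [hN k i (not_lt.1 hi)]
        exact Set.empty_subset _
    choose e he hs using he
    refine ⟨consAut σ e, isTreeAut_consAut σ e he, ?_⟩
    rintro (_ | ⟨i, l⟩)
    · exact h1
    · exact hs i l

namespace ForestNode

variable {h : ℕ}

/-! ### Nodes as sequences -/

/-- The sequence of the choices leading to a node, the first of which is the choice of a tree. -/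
def code {α : Type} (x : ForestNode h α α) : List α := x.tree :: x.branch

section code

variable {α : Type} {x y a b c : ForestNode h α α}

theorem length_code (x : ForestNode h α α) : x.code.length = (x.depth + 1) / 2 + 1 := by
  simp [code, x.length_branch]

/-- The depth is needed: a circle node and its only child have the same code. -/
theorem ext_code (hd : x.depth = y.depth) (hc : x.code = y.code) : x = y := by
  rw [code, code, List.cons.injEq] at hc
  exact ForestNode.ext hc.1 hd hc.2

theorem isAncestor_iff_code :
    a.IsAncestor b ↔ a.depth ≤ b.depth ∧ a.code <+: b.code := by
  rw [IsAncestor, code, code, List.cons_prefix_cons]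
  tauto

theorem depth_up (x : ForestNode h α α) :
    x.up.depth = if Odd x.depth then x.depth - 1 else x.depth := by
  unfold up
  split_ifs <;> rfl

/-- Written as a truncation, which tree automorphisms respect, with a length depending only on the
depth. -/
theorem code_up (x : ForestNode h α α) :
    x.up.code = x.code.take ((x.up.depth + 1) / 2 + 1) := by
  unfold up
  split_ifs with hx
  · obtain ⟨m, hm⟩ := hx
    simp only [code, List.take_succ_cons, List.dropLast_eq_take, x.length_branch]
    congr 2
    omega
  · rw [← length_code, List.take_length]

theorem depth_down (x : ForestNode h α α) :
    x.down.depth = if Odd x.depth ∧ x.depth + 1 < h then x.depth + 1 else x.depth := by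
  unfold down
  split_ifs <;> rfl

theorem code_down (x : ForestNode h α α) : x.down.code = x.code := by
  unfold down
  split_ifs <;> rfl

/-- The node of depth `d` with code `l`. -/
def ofCode (d : ℕ) (hd : d < h) (l : List α) (hl : l.length = (d + 1) / 2 + 1) :
    ForestNode h α α where
  tree := l.head (List.ne_nil_of_length_eq_add_one hl)
  depth := d
  depth_lt := hd
  branch := l.tail
  length_branch := by simp [hl]

@[simp]
theorem code_ofCode (d : ℕ) (hd : d < h) (l : List α) (hl : l.length = (d + 1) / 2 + 1) :
    (ofCode d hd l hl).code = l := List.cons_head_tail _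

@[simp]
theorem depth_ofCode (d : ℕ) (hd : d < h) (l : List α) (hl : l.length = (d + 1) / 2 + 1) :
    (ofCode d hd l hl).depth = d := rfl

/-! ### Lowest common ancestors -/

theorem IsAncestor.refl {ι β : Type} (a : ForestNode h ι β) : a.IsAncestor a :=
  ⟨rfl, le_rfl, List.prefix_rfl⟩

/-- A common ancestor of maximal depth works: the codes of all common ancestors are prefixes of
`a.code`, hence comparable. -/
theorem exists_isLCA (hab : a.tree = b.tree) : ∃ c, IsLCA c a b := by
  classical
  let D : Set ℕ := {d | ∃ c : ForestNode h α α, c.IsAncestor a ∧ c.IsAncestor b ∧ c.depth = d}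
  have hD : D.Nonempty := by
    refine ⟨0, ofCode 0 (Nat.zero_lt_of_lt a.depth_lt) [a.tree] rfl, ?_, ?_, rfl⟩
    · rw [isAncestor_iff_code, code_ofCode, depth_ofCode]
      simp [code]
    · rw [isAncestor_iff_code, code_ofCode, depth_ofCode]
      simp [code, hab]
  have hB : BddAbove D := ⟨h, by rintro _ ⟨c, -, -, rfl⟩; exact c.depth_lt.le⟩
  obtain ⟨c, hca, hcb, hc⟩ := Nat.sSup_mem hD hB
  refine ⟨c, hca, hcb, fun e hea heb => ?_⟩
  have hle : e.depth ≤ c.depth := hc ▸ le_csSup hB ⟨e, hea, heb, rfl⟩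
  rw [isAncestor_iff_code] at hea hca ⊢
  refine ⟨hle, List.prefix_of_prefix_length_le hea.2 hca.2 ?_⟩
  rw [length_code, length_code]
  omega

theorem exists_LCADepth (a b : ForestNode h α α) :
    ∃ i : Set.Icc (-1 : ℤ) ((h : ℤ) - 1), LCADepth i.1 a b := by
  by_cases hab : a.tree = b.tree
  · obtain ⟨c, hc⟩ := exists_isLCA hab
    have := c.depth_lt
    exact ⟨⟨c.depth, by constructor <;> omega⟩, Or.inl ⟨c, hc, rfl⟩⟩
  · exact ⟨⟨-1, by constructor <;> omega⟩, Or.inr ⟨hab, rfl⟩⟩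

theorem LCADepth.eq_depth {i : ℤ} (hi : LCADepth i a a) : i = a.depth := by
  obtain ⟨c, hc, rfl⟩ | ⟨hne, -⟩ := hi
  · have h1 := hc.1.2.1
    have h2 := (hc.2.2 a (.refl a) (.refl a)).2.1
    rw [le_antisymm h1 h2]
  · exact absurd rfl hne

/-- The depth of the lowest common ancestor determines the common prefixes of the codes. -/
theorem LCADepth.take_code_eq_iff {i : ℤ} (hi : LCADepth i a b) {r : ℕ}
    (ha : r + 1 ≤ a.code.length) (hb : r + 1 ≤ b.code.length) :
    a.code.take (r + 1) = b.code.take (r + 1) ↔ 0 ≤ i ∧ 2 * (r : ℤ) - 1 ≤ i := by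
  have hla := length_code a
  have hlb := length_code b
  have hda := a.depth_lt
  obtain ⟨c, hc, rfl⟩ | ⟨hne, rfl⟩ := hi
  · constructor
    · intro heq
      -- The least depth with codes of length `r + 1` is `2 * r - 1`, truncated to `0` for `r = 0`.
      -- In `ℤ` that case gives `-1`, whence the separate condition `0 ≤ i`.
      have hanc := hc.2.2 (ofCode (2 * r - 1) (by omega) (a.code.take (r + 1))
        (by rw [List.length_take]; omega))
        (isAncestor_iff_code.2 ⟨by rw [depth_ofCode]; omega, by
          rw [code_ofCode]; exact List.take_prefix _ _⟩)
        (isAncestor_iff_code.2 ⟨by rw [depth_ofCode]; omega, by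
          rw [code_ofCode, heq]; exact List.take_prefix _ _⟩)
      have := hanc.2.1
      rw [depth_ofCode] at this
      omega
    · rintro ⟨-, hr⟩
      have hlc := length_code c
      have key : ∀ x : ForestNode h α α, c.IsAncestor x →
          c.code.take (r + 1) = x.code.take (r + 1) := by
        intro x hx
        rw [List.prefix_iff_eq_take.1 (isAncestor_iff_code.1 hx).2, List.take_take]
        congr 1
        omega
      rw [← key a hc.1, ← key b hc.2.1]
  · simp [code, hne]

/-! ### Automorphisms of the forest -/

/-- The action of an automorphism of the tree of all sequences on the nodes. -/
def act (e : List α ≃ List α) (he : IsTreeAut e) (x : ForestNode h α α) : ForestNode h α α :=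
  ofCode x.depth x.depth_lt (e x.code) (by rw [he.length_eq, length_code])

@[simp]
theorem code_act (e : List α ≃ List α) (he : IsTreeAut e) (x : ForestNode h α α) :
    (act e he x).code = e x.code := code_ofCode _ _ _ _

@[simp]
theorem depth_act (e : List α ≃ List α) (he : IsTreeAut e) (x : ForestNode h α α) :
    (act e he x).depth = x.depth := rfl

theorem isAncestor_act {e : List α ≃ List α} (he : IsTreeAut e) :
    (act e he a).IsAncestor (act e he b) ↔ a.IsAncestor b := by
  simp only [isAncestor_iff_code, code_act, depth_act, he.prefix_iff]

theorem act_symm_act {e : List α ≃ List α} (he : IsTreeAut e) (x : ForestNode h α α) :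
    act e.symm he.symm (act e he x) = x := ext_code rfl (by simp)

theorem act_act_symm {e : List α ≃ List α} (he : IsTreeAut e) (x : ForestNode h α α) :
    act e he (act e.symm he.symm x) = x := ext_code rfl (by simp)

theorem act_up {e : List α ≃ List α} (he : IsTreeAut e) (x : ForestNode h α α) :
    act e he x.up = (act e he x).up := by
  have hd : x.up.depth = (act e he x).up.depth := (depth_up x).trans (depth_up (act e he x)).symm
  refine ext_code hd ?_
  rw [code_act, code_up, he, code_up, code_act, hd]

theorem act_down {e : List α ≃ List α} (he : IsTreeAut e) (x : ForestNode h α α) :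
    act e he x.down = (act e he x).down :=
  ext_code ((depth_down x).trans (depth_down (act e he x)).symm) (by simp only [code_act, code_down])

end code

/-- A map which reflects and preserves ancestors, equality of trees, and the range of which is
closed under ancestors preserves the depths of lowest common ancestors. -/
theorem LCADepth_map_iff {ι β ι' β' : Type} {f : ForestNode h ι β → ForestNode h ι' β'}
    (hd : ∀ x, (f x).depth = x.depth) (ht : ∀ x y, (f x).tree = (f y).tree ↔ x.tree = y.tree)
    (hf : ∀ x y, (f x).IsAncestor (f y) ↔ x.IsAncestor y)
    (hr : ∀ y x, y.IsAncestor (f x) → ∃ z, f z = y) (i : ℤ) (a b : ForestNode h ι β) :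
    LCADepth i (f a) (f b) ↔ LCADepth i a b := by
  have hlca : ∀ c, IsLCA (f c) (f a) (f b) ↔ IsLCA c a b := by
    intro c
    refine and_congr (hf _ _) (and_congr (hf _ _) ⟨fun H e h1 h2 => ?_, fun H e h1 h2 => ?_⟩)
    · exact (hf _ _).1 (H _ ((hf _ _).2 h1) ((hf _ _).2 h2))
    · obtain ⟨z, rfl⟩ := hr _ _ h1
      exact (hf _ _).2 (H _ ((hf _ _).1 h1) ((hf _ _).1 h2))
  refine or_congr ⟨?_, ?_⟩ (and_congr_left' (not_congr (ht a b)))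
  · rintro ⟨c, hc, rfl⟩
    obtain ⟨z, rfl⟩ := hr _ _ hc.1
    exact ⟨z, (hlca z).1 hc, by rw [hd]⟩
  · rintro ⟨c, hc, rfl⟩
    exact ⟨f c, (hlca c).2 hc, by rw [hd]⟩

theorem tree_eq_iff_code_take {α : Type} (x y : ForestNode h α α) :
    x.tree = y.tree ↔ x.code.take 1 = y.code.take 1 := by
  simp [code]

/-- The automorphism of the forest given by an automorphism of the tree of all sequences. -/
def actEquiv {α : Type} (e : List α ≃ List α) (he : IsTreeAut e) :
    ForestNode h α α ≃[forestLang h] ForestNode h α α where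
  toFun := act e he
  invFun := act e.symm he.symm
  left_inv := act_symm_act he
  right_inv := act_act_symm he
  map_fun' := by
    rintro _ (_ | _) x
    · exact act_up he (x 0)
    · exact act_down he (x 0)
  map_rel' := by
    rintro _ ⟨i⟩ x
    refine LCADepth_map_iff (f := act e he) (fun _ => rfl) (fun x y => ?_)
      (fun _ _ => isAncestor_act he)
      (fun y _ _ => ⟨_, act_act_symm he y⟩) i.1 (x 0) (x 1)
    rw [tree_eq_iff_code_take, tree_eq_iff_code_take, code_act, code_act, ← he, ← he,
      e.injective.eq_iff]

@[simp]
theorem actEquiv_apply {α : Type} (e : List α ≃ List α) (he : IsTreeAut e)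
    (x : ForestNode h α α) : actEquiv e he x = act e he x := rfl

/-- A finite partial map which preserves the depths of lowest common ancestors extends to an
automorphism. -/
theorem exists_automorphism_extending {α : Type} [Infinite α]
    {P : Set (ForestNode h α α × ForestNode h α α)}
    (hP : P.Finite)
    (hPi : ∀ p ∈ P, ∀ q ∈ P, ∀ i : Set.Icc (-1 : ℤ) ((h : ℤ) - 1),
      LCADepth i.1 p.1 q.1 → LCADepth i.1 p.2 q.2) :
    ∃ g : ForestNode h α α ≃[forestLang h] ForestNode h α α, ∀ p ∈ P, g p.1 = p.2 := by
  have hd : ∀ p ∈ P, p.1.depth = p.2.depth := by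
    intro p hp
    obtain ⟨i, hi⟩ := exists_LCADepth p.1 p.1
    exact_mod_cast hi.eq_depth.symm.trans (hPi p hp p hp i hi).eq_depth
  have hl : ∀ p ∈ P, p.1.code.length = p.2.code.length := fun p hp => by
    rw [length_code, length_code, hd p hp]
  obtain ⟨e, he, heP⟩ := exists_isTreeAut_extending (h + 1)
    ((fun p : ForestNode h α α × ForestNode h α α => (p.1.code, p.2.code)) '' P) (hP.image _) (by
      rintro _ ⟨p, -, rfl⟩
      have := p.1.depth_lt
      rw [length_code]
      omega) (by
      rintro _ ⟨p, hp, rfl⟩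
      exact hl p hp) (by
      rintro _ ⟨p, hp, rfl⟩ _ ⟨q, hq, rfl⟩ (_ | r) hjp hjq
      · simp
      -- Every pair has some depth `i`, and `i` settles the agreement of prefixes on both sides, so
      -- a one-way implication in `hPi` suffices.
      · obtain ⟨i, hi⟩ := exists_LCADepth p.1 q.1
        dsimp only at hjp hjq ⊢
        rw [hi.take_code_eq_iff hjp hjq,
          (hPi p hp q hq i hi).take_code_eq_iff (hl p hp ▸ hjp) (hl q hq ▸ hjq)])
  refine ⟨actEquiv e he, fun p hp => ext_code (hd p hp) ?_⟩
  rw [actEquiv_apply, code_act]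
  exact heP _ ⟨p, hp, rfl⟩

/-! ### Embeddings between forests -/

/-- Renaming the trees and the children. -/
def map {ι β ι' β' : Type} (f : ι → ι') (g : β → β') (x : ForestNode h ι β) :
    ForestNode h ι' β' where
  tree := f x.tree
  depth := x.depth
  depth_lt := x.depth_lt
  branch := x.branch.map g
  length_branch := by rw [List.length_map, x.length_branch]

section map

variable {ι β ι' β' : Type} {f : ι → ι'} {g : β → β'}

theorem map_up (x : ForestNode h ι β) : map f g x.up = (map f g x).up := by
  by_cases hx : Odd x.depth
  · rw [up, up, dif_pos hx, dif_pos (by exact hx)]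
    simp [map]
  · rw [up, up, dif_neg hx, dif_neg (by exact hx)]

theorem map_down (x : ForestNode h ι β) : map f g x.down = (map f g x).down := by
  by_cases hx : Odd x.depth ∧ x.depth + 1 < h
  · rw [down, down, dif_pos hx, dif_pos (by exact hx)]
    rfl
  · rw [down, down, dif_neg hx, dif_neg (by exact hx)]

theorem mem_range_map {y : ForestNode h ι' β'} (ht : y.tree ∈ Set.range f)
    (hb : ∀ b ∈ y.branch, b ∈ Set.range g) : ∃ x : ForestNode h ι β, map f g x = y := by
  obtain ⟨t, ht⟩ := ht
  obtain ⟨l, hl⟩ : y.branch ∈ Set.range (List.map g) := by rwa [Set.range_list_map]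
  refine ⟨⟨t, y.depth, y.depth_lt, l, ?_⟩, ForestNode.ext ht rfl hl⟩
  rw [← y.length_branch, ← hl, List.length_map]

/-- Renaming the trees and the children along injections is an embedding. -/
def mapEmbedding (hf : Function.Injective f) (hg : Function.Injective g) :
    ForestNode h ι β ↪[forestLang h] ForestNode h ι' β' where
  toFun := map f g
  inj' := fun x y hxy => by
    rw [ForestNode.ext_iff] at hxy
    exact ForestNode.ext (hf hxy.1) hxy.2.1 (List.map_injective_iff.2 hg hxy.2.2)
  map_fun' := by
    rintro _ (_ | _) x
    · exact map_up (x 0)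
    · exact map_down (x 0)
  map_rel' := by
    rintro _ ⟨i⟩ x
    refine LCADepth_map_iff (f := map f g) (fun _ => rfl) (fun x y => hf.eq_iff) (fun x y => ?_)
      (fun y x hy => ?_) i.1 (x 0) (x 1)
    · exact and_congr hf.eq_iff (and_congr_right' (List.prefix_map_iff_of_injective hg))
    · refine mem_range_map ⟨x.tree, hy.1.symm⟩ fun b hb => ?_
      obtain ⟨c, -, hc⟩ := List.mem_map.1 (hy.2.2.subset hb)
      exact ⟨c, hc⟩

end map

end ForestNode

open FirstOrder.Language in
/-- Any two embeddings of a finitely generated structure into the forest with infinitely many trees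
and infinite branching differ by an automorphism. -/
theorem ForestNode.exists_equiv_comp_eq {h : ℕ} {N : Type w} [(forestLang h).Structure N]
    (hN : Structure.FG (forestLang h) N) (φ ψ : N ↪[forestLang h] ForestNode h ℕ ℕ) :
    ∃ g : ForestNode h ℕ ℕ ≃[forestLang h] ForestNode h ℕ ℕ, ψ = g.toEmbedding.comp φ := by
  obtain ⟨A, hA, hcl⟩ := Structure.fg_iff.1 hN
  obtain ⟨g, hg⟩ := exists_automorphism_extending (P := (fun a => (φ a, ψ a)) '' A) (hA.image _) (by
    rintro _ ⟨a, -, rfl⟩ _ ⟨b, -, rfl⟩ i hi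
    have h1 := φ.map_rel (ForestRel.lcaDepth i : (forestLang h).Relations 2) ![a, b]
    have h2 := ψ.map_rel (ForestRel.lcaDepth i : (forestLang h).Relations 2) ![a, b]
    exact h2.2 (h1.1 hi))
  refine ⟨g, ?_⟩
  -- Only generators were matched, using only the predicates; `u` and `d` are respected because all
  -- maps are homomorphisms.
  have : ψ.toHom = (g.toEmbedding.comp φ).toHom :=
    Hom.eq_of_eqOn_dense hcl fun a ha => (hg _ ⟨a, ha, rfl⟩).symm
  exact DFunLike.ext _ _ fun x => DFunLike.congr_fun this x

open FirstOrder.Language in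
/-- A finitely generated structure embeds into the forest with infinitely many trees and infinite
branching if and only if it embeds into one of the finite forests. -/
theorem ForestNode.nonempty_embedding_iff {h : ℕ} {N : Type w} [(forestLang h).Structure N]
    (hN : Structure.FG (forestLang h) N) :
    Nonempty (N ↪[forestLang h] ForestNode h ℕ ℕ) ↔
      ∃ k l : ℕ, 1 ≤ k ∧ 1 ≤ l ∧ Nonempty (N ↪[forestLang h] FiniteForest h k l) := by
  constructor
  · rintro ⟨φ⟩
    obtain ⟨A, hA, hcl⟩ := Structure.fg_iff.1 hN
    obtain ⟨B, hB⟩ := (hA.biUnion fun a _ => (φ a).code.finite_toSet).bddAbove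
    have hB' : ∀ a ∈ A, ∀ n ∈ (φ a).code, n < B + 1 := fun a ha n hn =>
      Nat.lt_succ_of_le (hB (Set.mem_biUnion ha hn))
    let ι : FiniteForest h (B + 1) (B + 1) ↪[forestLang h] ForestNode h ℕ ℕ :=
      mapEmbedding Fin.val_injective Fin.val_injective
    -- The range of `ι` is a substructure, so it is enough that it contains the images of the
    -- generators.
    have hmem : ∀ x, φ x ∈ ι.toHom.range := by
      have hle : Substructure.closure (forestLang h) A ≤ ι.toHom.range.comap φ.toHom := by
        rw [Substructure.closure_le]
        intro a ha
        have hr : ∀ n ∈ (φ a).code, n ∈ Set.range (Fin.val : Fin (B + 1) → ℕ) := fun n hn =>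
          ⟨⟨n, hB' a ha n hn⟩, rfl⟩
        exact mem_range_map (hr _ List.mem_cons_self) fun b hb => hr _ (List.mem_cons_of_mem _ hb)
      intro x
      exact hle (hcl ▸ Substructure.mem_top x)
    exact ⟨B + 1, B + 1, by omega, by omega,
      ⟨ι.equivRange.symm.toEmbedding.comp (φ.codRestrict _ hmem)⟩⟩
  · rintro ⟨k, l, -, -, ⟨φ⟩⟩
    exact ⟨(mapEmbedding Fin.val_injective Fin.val_injective).comp φ⟩

instance ForestNode.instCountable {h : ℕ} {ι β : Type} [Countable ι] [Countable β] :
    Countable (ForestNode h ι β) := by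
  have hinj : Function.Injective fun x : ForestNode h ι β => (x.tree, x.depth, x.branch) := by
    intro x y hxy
    simp only [Prod.mk.injEq] at hxy
    exact ForestNode.ext hxy.1 hxy.2.1 hxy.2.2
  exact hinj.countable

open FirstOrder.Language in
/-- Every copy of the forest with infinitely many trees and infinite branching is a Fraïssé limit of
the class of finite forests. -/
theorem isFraisseLimit_of_equiv {h : ℕ} {M : Type w} [(forestLang h).Structure M] [Countable M]
    (E : M ≃[forestLang h] ForestNode h ℕ ℕ) :
    IsFraisseLimit (L := forestLang h) (forestClass.{w} h) M where
  ultrahomogeneous S hS f := by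
    -- The inclusion of `S` and `f` are compared as two embeddings of the same structure.
    obtain ⟨g, hg⟩ := ForestNode.exists_equiv_comp_eq (S.fg_iff_structure_fg.1 hS)
      (E.toEmbedding.comp S.subtype) (E.toEmbedding.comp f)
    refine ⟨E.symm.comp (g.comp E), ?_⟩
    ext x
    have hx : E (f x) = g (E x) := DFunLike.congr_fun hg x
    change f x = E.symm (g (E x))
    rw [← hx, E.symm_apply_apply]
  age := by
    ext N
    refine and_congr_right fun hN => ?_
    rw [← ForestNode.nonempty_embedding_iff hN]
    exact ⟨fun ⟨φ⟩ => ⟨E.toEmbedding.comp φ⟩, fun ⟨φ⟩ => ⟨E.symm.toEmbedding.comp φ⟩⟩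

/-! ### Configurations as labellings -/

section Configurations

variable {h : ℕ} {Q : FirstOrder.Language.{u, v}} {T : Type w}

/-- The position of an atomic formula of arity at most one in the tree of all sequences, together
with its predicate symbol and the depth of its argument. -/
def PAAtom.key (E : T → ForestNode h ℕ ℕ) (A : PAAtom Q T) :
    List ℕ × ((Σ n, Q.Relations n) × Option (Fin h)) :=
  if hA : 0 < A.arity then
    ((E (A.args ⟨0, hA⟩)).code, ⟨A.arity, A.symb⟩, some ⟨_, (E (A.args ⟨0, hA⟩)).depth_lt⟩)
  else ([], ⟨A.arity, A.symb⟩, none)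

/-- An atom of arity at most 1 is its symbol and at most one node, and a node is recovered from code
and depth. -/
theorem PAAtom.key_injective (hQ : ∀ n, Nonempty (Q.Relations n) → n ≤ 1)
    {E : T → ForestNode h ℕ ℕ} (hE : Function.Injective E) :
    Function.Injective (PAAtom.key (Q := Q) E) := by
  rintro ⟨n, q, a⟩ ⟨m, q', b⟩ hab
  have hn := hQ n ⟨q⟩
  have hsymb : (⟨n, q⟩ : Σ n, Q.Relations n) = ⟨m, q'⟩ := by
    unfold PAAtom.key at hab
    split_ifs at hab
    all_goals
      simp only [Prod.mk.injEq] at hab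
      exact hab.2.1
  cases hsymb
  congr 1
  funext i
  have hpos : 0 < n := i.pos
  obtain rfl : i = ⟨0, hpos⟩ := Fin.ext (by omega)
  simp only [PAAtom.key, hpos, dif_pos, Prod.mk.injEq, Option.some.injEq, Fin.mk.injEq] at hab
  exact hE (ForestNode.ext_code hab.2.2 hab.1)

/-- Nullary atoms sit at `[]`, which every tree automorphism fixes, just as renaming nodes leaves
them unchanged. -/
theorem PAAtom.key_map {E : T → ForestNode h ℕ ℕ} {π : T → T} {e : List ℕ ≃ List ℕ}
    (he : IsTreeAut e) (hπ : ∀ x, E (π x) = ForestNode.act e he (E x)) (A : PAAtom Q T) :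
    (A.map π).key E = (e (A.key E).1, (A.key E).2) := by
  by_cases hA : 0 < A.arity
  · simp [PAAtom.key, PAAtom.map, hA, hπ]
  · simp [PAAtom.key, PAAtom.map, hA, he.apply_nil]

/-- The labelling of the tree of all sequences given by a configuration. -/
def PAConfig.labelling (E : T → ForestNode h ℕ ℕ) (C : PAConfig Q T) (l : List ℕ) :
    Set ((Σ n, Q.Relations n) × Option (Fin h)) :=
  {x | ∃ A ∈ C, A.key E = (l, x)}

/-- Domination yields an atom of `C'` with the key of the renamed atom of `C`; injectivity of keys
identifies the two. -/
theorem covers_of_dominated [(forestLang h).Structure T]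
    (hQ : ∀ n, Nonempty (Q.Relations n) → n ≤ 1) (E : T ≃[forestLang h] ForestNode h ℕ ℕ)
    {C C' : PAConfig Q T} (hC : Dominated (PAConfig.labelling E C) (PAConfig.labelling E C')) :
    Covers (forestLang h) C C' := by
  obtain ⟨e, he, hl⟩ := hC
  refine ⟨E.symm.comp ((ForestNode.actEquiv e he).comp E), fun A hA => ?_⟩
  obtain ⟨A', hA', hkey⟩ := hl (A.key E).1 (show (A.key E).2 ∈ _ from ⟨A, hA, rfl⟩)
  have hmap := PAAtom.key_map (Q := Q) (E := E)
    (π := E.symm.comp ((ForestNode.actEquiv e he).comp E)) he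
    (fun x => E.apply_symm_apply _) A
  rwa [PAAtom.key_injective hQ E.injective (hmap.trans hkey.symm)]

theorem PAConfig.labelling_mem (E : T → ForestNode h ℕ ℕ) (C : PAConfig Q T) :
    {l | (PAConfig.labelling E C l).Nonempty}.Finite ∧
      ∀ l, h + 2 ≤ l.length → PAConfig.labelling E C l = ∅ := by
  constructor
  · refine (C.finite_toSet.image fun A => (A.key E).1).subset ?_
    rintro l ⟨x, A, hA, hkey⟩
    exact ⟨A, hA, congrArg Prod.fst hkey⟩
  · intro l hl
    refine Set.eq_empty_iff_forall_notMem.2 ?_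
    rintro x ⟨A, -, hkey⟩
    have hlen : (A.key E).1.length ≤ h + 1 := by
      unfold PAAtom.key
      split_ifs with hA
      · have := (E (A.args ⟨0, hA⟩)).depth_lt
        simp only [ForestNode.length_code]
        omega
      · simp
    rw [hkey] at hlen
    dsimp only at hlen
    omega

theorem wellQuasiOrdered_covers [(forestLang h).Structure T] [Finite (Σ n, Q.Relations n)]
    (hQ : ∀ n, Nonempty (Q.Relations n) → n ≤ 1) (E : T ≃[forestLang h] ForestNode h ℕ ℕ) :
    WellQuasiOrdered (Covers (Q := Q) (T := T) (forestLang h)) := by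
  intro f
  obtain ⟨i, j, hij, hd⟩ := (partiallyWellOrderedOn_dominated (h + 2)).exists_lt
    (f := fun i => PAConfig.labelling E (f i)) fun i => PAConfig.labelling_mem E (f i)
  exact ⟨i, j, hij, covers_of_dominated hQ E hd⟩

instance Covers.isPreorder (L : FirstOrder.Language.{0, 0}) [L.Structure T] :
    IsPreorder (PAConfig Q T) (Covers L) where
  refl _ := ⟨FirstOrder.Language.Equiv.refl L T, fun _ hA => hA⟩
  trans _ _ _ := fun ⟨π, h1⟩ ⟨π', h2⟩ => ⟨π'.comp π, fun A hA => h2 _ (h1 A hA)⟩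

end Configurations

theorem mainTheorem12 (h : ℕ) (hh : 1 ≤ h) :
    (∃ (T : Type w) (_ : (forestLang h).Structure T) (_ : Countable T),
      FirstOrder.Language.IsFraisseLimit (L := forestLang h) (forestClass.{w} h) T) ∧
    ∀ (T : Type w) [(forestLang h).Structure T] [Countable T],
      FirstOrder.Language.IsFraisseLimit (L := forestLang h) (forestClass.{w} h) T →
      ∀ (Q : FirstOrder.Language.{u, v}) [Q.IsRelational] [Finite (Σ n, Q.Relations n)],
        (∀ n, Nonempty (Q.Relations n) → n ≤ 1) →
        ∀ 𝒞 : Set (PAConfig Q T),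
          IsPreorder 𝒞 (fun C C' => Covers (forestLang h) C.1 C'.1) ∧
          WellQuasiOrdered (fun C C' : 𝒞 => Covers (forestLang h) C.1 C'.1) := by
  let _ : (forestLang h).Structure (ULift.{w} (ForestNode h ℕ ℕ)) :=
    (Equiv.ulift.symm : ForestNode h ℕ ℕ ≃ ULift.{w} (ForestNode h ℕ ℕ)).inducedStructure
  have hlim := isFraisseLimit_of_equiv
    (Equiv.ulift.symm : ForestNode h ℕ ℕ ≃ ULift.{w} (ForestNode h ℕ ℕ)).inducedStructureEquiv.symm
  refine ⟨⟨_, _, inferInstance, hlim⟩, ?_⟩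
  intro T _ _ hT Q _ _ hQ 𝒞
  -- Uniqueness of Fraïssé limits reduces an arbitrary limit to the concrete forest, lifted to the
  -- universe of `T`.
  obtain ⟨E⟩ := hT.nonempty_equiv hlim
  refine ⟨{ refl := fun C => refl_of (Covers (forestLang h)) C.1
            trans := fun _ _ _ => trans_of (Covers (forestLang h)) }, fun f => ?_⟩
  exact wellQuasiOrdered_covers hQ (Equiv.inducedStructureEquiv _ |>.symm.comp E) fun i => (f i).1
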